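/- For a finite simple graph $G$ with vertex set $V$, let $\mathcal{S}(G)$ be the set of all real symmetric matrices $M=(M_{uv})_{u,v\in V}$ such that, for all distinct $u,v\in V$, $M_{uv}=0$ if and only if $\{u,v\}$ is not an edge of $G$ (the diagonal entries are arbitrary). Let $q(G)$ be the minimum, over all $M\in\mathcal{S}(G)$, of the number of distinct eigenvalues of $M$. For integers $n>d\ge 1$, the Johnson graph $J(n,d)$ is the graph whose vertices are the $d$-element subsets of $\{1,\dots,n\}$, two of them being adjacent when their intersection has exactly $d-1$ elements. Theorem. Let $d\ge 2$ be an integer, and let $G$ be the complement of the Johnson graph $J(3d-2,d)$. Then $q(G)=2$. -/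

import Mathlib

/-- The Johnson graph `J(n, d)`: the vertices are the `d`-subsets of an `n`-set, and two of them
are adjacent when their intersection has size `d - 1` (written without truncated subtraction). -/
def johnsonGraph (n d : ℕ) : SimpleGraph {s : Finset (Fin n) // s.card = d} where
  Adj s t := (s.1 ∩ t.1).card + 1 = d
  symm := ⟨fun s t h => by rwa [Finset.inter_comm]⟩
  loopless := ⟨fun s h => by
    rw [Finset.inter_self, s.2] at h
    omega⟩

/-- The set `S(G)` of real symmetric matrices indexed by the vertices of `G` whose off-diagonal
entries are nonzero exactly at the edges of `G`; the diagonal is arbitrary. -/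
def symmetricMatrices {V : Type*} (G : SimpleGraph V) : Set (Matrix V V ℝ) :=
  {M | M.IsSymm ∧ ∀ u v, u ≠ v → (M u v = 0 ↔ ¬ G.Adj u v)}

/-- The number `q(M)` of distinct eigenvalues of a real square matrix. It is only used for symmetric
matrices, all of whose eigenvalues are real. -/
noncomputable def numDistinctEigenvalues {V : Type*} [Fintype V] [DecidableEq V]
    (M : Matrix V V ℝ) : ℕ :=
  {μ : ℝ | Module.End.HasEigenvalue (Matrix.toLin' M) μ}.ncard

/-- The minimum number `q(G)` of distinct eigenvalues over all matrices in `S(G)`. The set of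
values is nonempty (it contains the value at the adjacency matrix), so this infimum of natural
numbers is a minimum. -/
noncomputable def minDistinctEigenvalues {V : Type*} [Fintype V] [DecidableEq V]
    (G : SimpleGraph V) : ℕ :=
  sInf (numDistinctEigenvalues '' symmetricMatrices G)

/-! Let `A` be the adjacency matrix of J(n,d), n = 3d-2. Its eigenvalue (d-j)(n-d-j) - j vanishes at
j = d-1, so `A` is singular. The projection onto ker `A` lies in the Johnson scheme: its entries
depend only on intersection sizes. The diagonal of `A` times it is zero, which forces its entries on
Johnson edges to vanish; an explicit formula shows that all others are nonzero. A multiple `M` of it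
is thus in S(G) with at most two eigenvalues. To get `M * M = c • M` without the full spectrum: the
columns of `M` lie in ker `A`, and every scheme matrix, being a polynomial in `A`, acts on ker `A`
as a scalar. -/

open Finset in
/-- The sum of `v` over all sets obtained from `S` by exchanging one element of `S` for one outside
of it, i.e. over the neighbours of `S` in the Johnson graph. -/
noncomputable def swapSum {α : Type*} [Fintype α] [DecidableEq α] (v : Finset α → ℝ)
    (S : Finset α) : ℝ :=
  ∑ a ∈ S, ∑ b ∈ Sᶜ, v (insert b (S.erase a))

/-- The action of `swapSum` on functions of the size of the intersection with a fixed `d`-set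
of an `n`-set. -/
noncomputable def swapCoeff (n d : ℕ) (g : ℕ → ℝ) (k : ℕ) : ℝ :=
  (d - k : ℝ) ^ 2 * g (k + 1) + k * (n - 2 * d + k : ℝ) * g (k - 1)
    + (k * (d - k) + (d - k) * (n - 2 * d + k) : ℝ) * g k

/-! ### The Johnson scheme acting on ker `A` -/

theorem card_swap_inter {α : Type*} [DecidableEq α] {S T : Finset α} {a b : α}
    (ha : a ∈ S) (hb : b ∉ S) :
    (insert b (S.erase a) ∩ T).card + (if a ∈ T then 1 else 0)
      = (S ∩ T).card + (if b ∈ T then 1 else 0) := by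
  have h1 : ((S ∩ T).erase a).card + (if a ∈ T then 1 else 0) = (S ∩ T).card := by
    split_ifs with h
    · exact Finset.card_erase_add_one (Finset.mem_inter.2 ⟨ha, h⟩)
    · rw [Finset.erase_eq_of_notMem (fun h' => h (Finset.mem_inter.1 h').2), add_zero]
  have h2 : (insert b (S.erase a) ∩ T).card
      = ((S ∩ T).erase a).card + (if b ∈ T then 1 else 0) := by
    split_ifs with h
    · rw [Finset.insert_inter_of_mem h, Finset.erase_inter, Finset.card_insert_of_notMem]
      simp [hb]
    · rw [Finset.insert_inter_of_notMem h, Finset.erase_inter, add_zero]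
  omega

theorem swapSum_card_inter {α : Type*} [Fintype α] [DecidableEq α] {d : ℕ} {S T : Finset α}
    (hS : S.card = d) (hT : T.card = d) (g : ℕ → ℝ) :
    swapSum (fun U => g (U ∩ T).card) S
      = swapCoeff (Fintype.card α) d g (S ∩ T).card := by
  have h1 : ((S \ T).card : ℝ) = d - (S ∩ T).card := by
    rw [eq_sub_iff_add_eq, ← hS]
    exact_mod_cast Finset.card_sdiff_add_card_inter S T
  have h2 : ((T \ S).card : ℝ) = d - (S ∩ T).card := by
    rw [eq_sub_iff_add_eq, ← hT, Finset.inter_comm]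
    exact_mod_cast Finset.card_sdiff_add_card_inter T S
  have h3 : ((Sᶜ \ T).card : ℝ) = Fintype.card α - 2 * d + (S ∩ T).card := by
    have e1 : ((Sᶜ \ T).card : ℝ) + (Sᶜ ∩ T).card = (Sᶜ).card := by
      exact_mod_cast Finset.card_sdiff_add_card_inter Sᶜ T
    have e2 : ((Sᶜ).card : ℝ) + d = Fintype.card α := by
      rw [← hS]
      exact_mod_cast Finset.card_compl_add_card S
    have e3 : Sᶜ ∩ T = T \ S := by ext; simp [and_comm]
    rw [e3, h2] at e1
    linarith
  have h4 : Sᶜ ∩ T = T \ S := by ext; simp [and_comm]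
  have key : ∀ a ∈ S, ∀ b ∈ Sᶜ, g (insert b (S.erase a) ∩ T).card
      = if a ∈ T then (if b ∈ T then g (S ∩ T).card else g ((S ∩ T).card - 1))
        else (if b ∈ T then g ((S ∩ T).card + 1) else g (S ∩ T).card) := by
    intro a ha b hb
    have := card_swap_inter (T := T) ha (Finset.mem_compl.1 hb)
    split_ifs with p q q <;> simp only [p, q, if_true, if_false] at this <;> congr 1 <;> omega
  unfold swapSum swapCoeff
  rw [Finset.sum_congr rfl fun a ha => Finset.sum_congr rfl (key a ha)]
  simp only [Finset.sum_ite_irrel]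
  simp only [Finset.sum_ite, Finset.sum_const, Finset.filter_mem_eq_inter,
    Finset.filter_notMem_eq_sdiff, nsmul_eq_mul, h1, h2, h3, h4]
  ring

/-- If the scheme matrix `B` of `g` satisfies `B v = c v` and `A v = 0`, then `A B v = c A v = 0`;
`swapCoeff` gives the entries of `A B`. -/
theorem sum_swapCoeff_mul_eq_zero {α : Type*} [Fintype α] [DecidableEq α] {d : ℕ} {g : ℕ → ℝ}
    {c : ℝ} {v : Finset α → ℝ} (hv : ∀ S, S.card = d → swapSum v S = 0)
    (h : ∀ S, S.card = d →
      ∑ T ∈ Finset.univ.powersetCard d, g (S ∩ T).card * v T = c * v S)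
    {S : Finset α} (hS : S.card = d) :
    ∑ T ∈ Finset.univ.powersetCard d, swapCoeff (Fintype.card α) d g (S ∩ T).card * v T = 0 := by
  have e1 : ∀ T ∈ Finset.univ.powersetCard d,
      swapCoeff (Fintype.card α) d g (S ∩ T).card * v T
        = ∑ a ∈ S, ∑ b ∈ Sᶜ, g (insert b (S.erase a) ∩ T).card * v T := by
    intro T hT
    rw [← swapSum_card_inter hS (Finset.mem_powersetCard.1 hT).2, swapSum, Finset.sum_mul]
    simp only [Finset.sum_mul]
  have e2 : ∀ a ∈ S, ∀ b ∈ Sᶜ,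
      ∑ T ∈ Finset.univ.powersetCard d, g (insert b (S.erase a) ∩ T).card * v T
        = c * v (insert b (S.erase a)) := by
    intro a ha b hb
    refine h _ ?_
    rw [Finset.card_insert_of_notMem fun h' => Finset.mem_compl.1 hb (Finset.mem_of_mem_erase h'),
      Finset.card_erase_add_one ha, hS]
  rw [Finset.sum_congr rfl e1, Finset.sum_comm]
  simp only [Finset.sum_comm (s := Finset.univ.powersetCard d)]
  rw [Finset.sum_congr rfl fun a ha => Finset.sum_congr rfl (e2 a ha)]
  simp only [← Finset.mul_sum]
  rw [show ∑ a ∈ S, ∑ b ∈ Sᶜ, v (insert b (S.erase a)) = 0 from hv S hS, mul_zero]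

/-- The three-term recurrence for `A` times the distance-`i` matrix. Writing `d + 1` makes room for
distance `i - 1` without subtraction. -/
theorem swapCoeff_indicator (n d i k : ℕ) :
    swapCoeff n d (fun m => if m + (i + 1) = d + 1 then 1 else 0) k
      = (i + 1 : ℝ) ^ 2 * (if k + (i + 2) = d + 1 then 1 else 0)
        + (d + 1 - i : ℝ) * (n - d + 1 - i) * (if k + i = d + 1 then 1 else 0)
        + ((d - i) * i + i * (n - d - i) : ℝ) * (if k + (i + 1) = d + 1 then 1 else 0) := by
  have t1 : (d - k : ℝ) ^ 2 * (if k + 1 + (i + 1) = d + 1 then 1 else 0)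
      = (i + 1 : ℝ) ^ 2 * (if k + (i + 2) = d + 1 then 1 else 0) := by
    by_cases h : k + (i + 2) = d + 1
    · obtain rfl : d = k + i + 1 := by omega
      rw [if_pos h, if_pos (by omega)]
      push_cast
      ring
    · rw [if_neg h, if_neg (by omega), mul_zero, mul_zero]
  have t2 : (k * (n - 2 * d + k) : ℝ) * (if k - 1 + (i + 1) = d + 1 then 1 else 0)
      = (d + 1 - i : ℝ) * (n - d + 1 - i) * (if k + i = d + 1 then 1 else 0) := by
    by_cases h : k + i = d + 1
    · have hi : (i : ℝ) = d + 1 - k := by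
        rw [eq_sub_iff_add_eq, add_comm]
        exact_mod_cast h
      rcases Nat.eq_zero_or_pos k with rfl | hk
      · rw [hi]
        push_cast
        ring
      · rw [if_pos h, if_pos (by omega), hi]
        ring
    · rw [if_neg h, mul_zero]
      rcases Nat.eq_zero_or_pos k with rfl | hk
      · simp
      · rw [if_neg (by omega), mul_zero]
  have t3 : (k * (d - k) + (d - k) * (n - 2 * d + k) : ℝ)
        * (if k + (i + 1) = d + 1 then 1 else 0)
      = ((d - i) * i + i * (n - d - i) : ℝ) * (if k + (i + 1) = d + 1 then 1 else 0) := by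
    split_ifs with h
    · obtain rfl : d = k + i := by omega
      push_cast
      ring
    · rw [mul_zero, mul_zero]
  unfold swapCoeff
  rw [t1, t2, t3]

/-- A function on `d`-sets annihilated by the Johnson graph is an eigenvector of every matrix
of the Johnson scheme. -/
theorem exists_eigenvalue_of_swapSum_eq_zero {α : Type*} [Fintype α] [DecidableEq α] (d : ℕ)
    (g : ℕ → ℝ) :
    ∃ c : ℝ, ∀ v : Finset α → ℝ, (∀ S, S.card = d → swapSum v S = 0) →
      ∀ S, S.card = d →
        ∑ T ∈ Finset.univ.powersetCard d, g (S ∩ T).card * v T = c * v S := by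
  -- Index `i` means distance `i - 1`, so the induction starts from the zero matrix and the
  -- identity.
  have shifted : ∀ i, ∃ c : ℝ, ∀ v : Finset α → ℝ,
      (∀ S, S.card = d → swapSum v S = 0) → ∀ S, S.card = d →
        ∑ T ∈ Finset.univ.powersetCard d, (if (S ∩ T).card + i = d + 1 then 1 else 0 : ℝ) * v T
          = c * v S := by
    intro i
    induction i using Nat.twoStepInduction with
    | zero =>
      refine ⟨0, fun v _ S hS => ?_⟩
      rw [zero_mul]
      refine Finset.sum_eq_zero fun T _ => ?_
      have : (S ∩ T).card ≤ S.card := Finset.card_le_card Finset.inter_subset_left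
      rw [if_neg (by omega), zero_mul]
    | one =>
      refine ⟨1, fun v _ S hS => ?_⟩
      rw [one_mul, Finset.sum_eq_single S]
      · rw [Finset.inter_self, hS, if_pos rfl, one_mul]
      · intro T hT hne
        have hT := (Finset.mem_powersetCard.1 hT).2
        rw [if_neg, zero_mul]
        intro h
        have hST : S ∩ T = S := Finset.eq_of_subset_of_card_le Finset.inter_subset_left (by omega)
        exact hne (Finset.eq_of_subset_of_card_le (Finset.inter_eq_left.1 hST) (by omega)).symm
      · intro h
        exact absurd (Finset.mem_powersetCard.2 ⟨Finset.subset_univ S, hS⟩) h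
    | more i ih0 ih1 =>
      obtain ⟨c0, h0⟩ := ih0
      obtain ⟨c1, h1⟩ := ih1
      -- The recurrence solved for its top term, whose coefficient `(i + 1) ^ 2` is nonzero.
      refine ⟨-((d + 1 - i : ℝ) * (Fintype.card α - d + 1 - i) * c0
        + ((d - i) * i + i * (Fintype.card α - d - i) : ℝ) * c1) / (i + 1 : ℝ) ^ 2,
        fun v hv S hS => ?_⟩
      have h := sum_swapCoeff_mul_eq_zero
        (g := fun m => if m + (i + 1) = d + 1 then 1 else 0) hv (h1 v hv) hS
      simp only [swapCoeff_indicator, add_mul, Finset.sum_add_distrib, mul_assoc,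
        ← Finset.mul_sum] at h
      rw [h0 v hv S hS, h1 v hv S hS] at h
      have hi : (i + 1 : ℝ) ^ 2 ≠ 0 := by positivity
      rw [div_mul_eq_mul_div, eq_div_iff hi]
      linear_combination h
  have single : ∀ i, ∃ c : ℝ, ∀ v : Finset α → ℝ,
      (∀ S, S.card = d → swapSum v S = 0) → ∀ S, S.card = d →
        ∑ T ∈ Finset.univ.powersetCard d, (if (S ∩ T).card + i = d then 1 else 0 : ℝ) * v T
          = c * v S := by
    intro i
    obtain ⟨c, hc⟩ := shifted (i + 1)
    simp only [← add_assoc, add_left_inj] at hc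
    exact ⟨c, hc⟩
  choose c hc using single
  refine ⟨∑ i ∈ Finset.range (d + 1), g (d - i) * c i, fun v hv S hS => ?_⟩
  rw [Finset.sum_mul]
  have : ∀ i ∈ Finset.range (d + 1), g (d - i) * c i * v S
      = ∑ T ∈ Finset.univ.powersetCard d,
        g (d - i) * ((if (S ∩ T).card + i = d then 1 else 0 : ℝ) * v T) := by
    intro i _
    rw [mul_assoc, ← hc i v hv S hS, Finset.mul_sum]
  rw [Finset.sum_congr rfl this, Finset.sum_comm]
  refine Finset.sum_congr rfl fun T _ => ?_
  have hk : (S ∩ T).card ≤ d := hS ▸ Finset.card_le_card Finset.inter_subset_left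
  rw [Finset.sum_eq_single (d - (S ∩ T).card)]
  · rw [if_pos (by omega), one_mul, Nat.sub_sub_self hk]
  · intro i _ hi
    rw [if_neg (by omega), zero_mul, mul_zero]
  · intro h
    exact absurd (Finset.mem_range.2 (by omega)) h

/-! ### The kernel entries -/

/-- The entries of the projection onto the kernel of the Johnson graph `J(3d-2, d)`, as a function
of the size of the intersection. -/
noncomputable def kernelEntry (d k : ℕ) : ℝ :=
  (-1) ^ (d - k) * (1 - (d - k : ℕ)) / ((2 * d - 2).choose (d - k) : ℝ)

theorem kernelEntry_self (d : ℕ) : kernelEntry d d = 1 := by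
  simp [kernelEntry]

theorem kernelEntry_eq_zero_iff {d k : ℕ} (hd : 2 ≤ d) : kernelEntry d k = 0 ↔ k + 1 = d := by
  have h : ((2 * d - 2).choose (d - k) : ℝ) ≠ 0 := by
    exact_mod_cast (Nat.choose_pos (by omega)).ne'
  have h' : (1 - ((d - k : ℕ) : ℝ) = 0) ↔ k + 1 = d := by
    rw [sub_eq_zero, eq_comm, Nat.cast_eq_one]
    omega
  simp [kernelEntry, h, h']

/-- With `i = d - k` and `N = n - d = 2d - 2`, adjacent binomials differ by simple ratios, so all
three terms have denominator `N.choose i`. At `i = 0` and `k = 0` the out-of-range entries have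
coefficient zero. -/
theorem swapCoeff_kernelEntry {d k : ℕ} (hd : 2 ≤ d) (hk : k ≤ d) :
    swapCoeff (3 * d - 2) d (kernelEntry d) k = 0 := by
  obtain ⟨i, rfl⟩ := Nat.exists_eq_add_of_le hk
  have hn : ((3 * (k + i) - 2 : ℕ) : ℝ) = 3 * (k + i) - 2 := by
    rw [Nat.cast_sub (by omega)]
    push_cast
    ring
  have hN : ((2 * (k + i) - 2 : ℕ) : ℝ) = 2 * (k + i) - 2 := by
    rw [Nat.cast_sub (by omega)]
    push_cast
    ring
  set N := 2 * (k + i) - 2 with hNdef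
  have hCi : (N.choose i : ℝ) ≠ 0 := by exact_mod_cast (Nat.choose_pos (by omega)).ne'
  have hmid : kernelEntry (k + i) k = (-1) ^ i * (1 - i) / (N.choose i : ℝ) := by
    rw [kernelEntry, Nat.add_sub_cancel_left]
  have hup : (i : ℝ) ^ 2 * kernelEntry (k + i) (k + 1)
      = -((-1) ^ i * i * (N - i + 1) * (2 - i)) / (N.choose i : ℝ) := by
    cases i with
    | zero => simp
    | succ j =>
      have hC : (N.choose (j + 1) : ℝ) * (j + 1) = N.choose j * (N - j) := by
        have := Nat.choose_succ_right_eq N j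
        rw [← Nat.cast_sub (by omega)]
        exact_mod_cast this
      have hCj : (N.choose j : ℝ) ≠ 0 := by exact_mod_cast (Nat.choose_pos (by omega)).ne'
      rw [kernelEntry, show k + (j + 1) - (k + 1) = j by omega, ← mul_div_assoc,
        div_eq_div_iff hCj hCi]
      push_cast
      rw [pow_succ]
      linear_combination (-1) ^ j * (1 - j : ℝ) * (j + 1) * hC
  have hdown : (k * (N - i) : ℝ) * kernelEntry (k + i) (k - 1)
      = (-1) ^ i * i * k * (i + 1) / (N.choose i : ℝ) := by
    cases k with
    | zero => simp
    | succ j =>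
      have hC : (N.choose (i + 1) : ℝ) * (i + 1) = N.choose i * (N - i) := by
        have := Nat.choose_succ_right_eq N i
        rw [← Nat.cast_sub (by omega)]
        exact_mod_cast this
      have hCj : (N.choose (i + 1) : ℝ) ≠ 0 := by exact_mod_cast (Nat.choose_pos (by omega)).ne'
      rw [kernelEntry, show j + 1 + i - (j + 1 - 1) = i + 1 by omega, ← mul_div_assoc,
        div_eq_div_iff hCj hCi]
      push_cast
      rw [pow_succ]
      linear_combination -(-1) ^ i * (i : ℝ) * (j + 1) * hC
  have hkN : (k : ℝ) * ((3 * (k + i) - 2 : ℝ) - 2 * (k + i) + k) = k * (N - i) := by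
    rw [hN]
    ring
  unfold swapCoeff
  rw [hn]
  push_cast
  rw [hkN, add_sub_cancel_left, hup, hdown, hmid, hN]
  field_simp
  ring

/-! ### Bounds on the number of eigenvalues -/

/-- A symmetric matrix with a single eigenvalue is scalar by the spectral theorem. -/
theorem two_le_numDistinctEigenvalues {V : Type*} [Fintype V] [DecidableEq V]
    {M : Matrix V V ℝ} (hM : M.IsSymm) {u v : V} (huv : u ≠ v) (h : M u v ≠ 0) :
    2 ≤ numDistinctEigenvalues M := by
  have hH : M.IsHermitian := by
    rw [Matrix.IsHermitian, Matrix.conjTranspose_eq_transpose_of_trivial]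
    exact hM
  by_contra hlt
  have hfin : {μ : ℝ | Module.End.HasEigenvalue (Matrix.toLin' M) μ}.Finite :=
    Module.End.finite_hasEigenvalue _
  have hle : {μ : ℝ | Module.End.HasEigenvalue (Matrix.toLin' M) μ}.ncard ≤ 1 := by
    unfold numDistinctEigenvalues at hlt
    omega
  rw [Set.ncard_le_one hfin] at hle
  have hmem : ∀ i, Module.End.HasEigenvalue (Matrix.toLin' M) (hH.eigenvalues i) := by
    intro i
    refine Module.End.hasEigenvalue_of_hasEigenvector
      (x := (hH.eigenvectorBasis i).ofLp) ⟨?_, ?_⟩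
    · rw [Module.End.mem_eigenspace_iff, Matrix.toLin'_apply]
      exact hH.mulVec_eigenvectorBasis i
    · intro h0
      exact hH.eigenvectorBasis.orthonormal.ne_zero i (by ext j; exact congrFun h0 j)
  have hconst : hH.eigenvalues = fun _ => hH.eigenvalues u :=
    funext fun i => hle _ (hmem i) _ (hmem u)
  apply h
  have hs := hH.spectral_theorem
  rw [hconst] at hs
  have hd : (Matrix.diagonal (RCLike.ofReal ∘ fun _ => hH.eigenvalues u) : Matrix V V ℝ)
      = hH.eigenvalues u • 1 := by
    rw [Matrix.smul_one_eq_diagonal]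
    rfl
  rw [hd, map_smul, map_one] at hs
  rw [hs, Matrix.smul_apply, Matrix.one_apply_ne huv, smul_zero]

theorem two_le_minDistinctEigenvalues {V : Type*} [Fintype V] [DecidableEq V]
    {G : SimpleGraph V} {u v : V} (h : G.Adj u v) (hne : (symmetricMatrices G).Nonempty) :
    2 ≤ minDistinctEigenvalues G := by
  obtain ⟨M, hM, hM'⟩ := Nat.sInf_mem (hne.image numDistinctEigenvalues)
  unfold minDistinctEigenvalues
  rw [← hM']
  exact two_le_numDistinctEigenvalues hM.1 h.ne fun h0 => (hM.2 u v h.ne).1 h0 h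

theorem numDistinctEigenvalues_le_two {V : Type*} [Fintype V] [DecidableEq V]
    {M : Matrix V V ℝ} {c : ℝ} (h : M * M = c • M) : numDistinctEigenvalues M ≤ 2 := by
  have hsub : {μ : ℝ | Module.End.HasEigenvalue (Matrix.toLin' M) μ} ⊆ {0, c} := by
    intro μ hμ
    obtain ⟨x, hx, hx0⟩ := Module.End.HasEigenvalue.exists_hasEigenvector hμ
    rw [Module.End.mem_eigenspace_iff, Matrix.toLin'_apply] at hx
    have h1 : (M * M).mulVec x = (μ * μ) • x := by
      rw [← Matrix.mulVec_mulVec, hx, Matrix.mulVec_smul, hx, smul_smul]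
    rw [h, Matrix.smul_mulVec, hx, smul_smul] at h1
    have h2 : c * μ = μ * μ := smul_left_injective ℝ hx0 h1
    rcases eq_or_ne μ 0 with h0 | h0
    · exact Or.inl h0
    · exact Or.inr (mul_right_cancel₀ h0 h2).symm
  exact (Set.ncard_le_ncard hsub (Set.toFinite _)).trans (by
    simpa using Set.ncard_insert_le (0 : ℝ) {c})

/-- A multiple of the projection onto the kernel of the Johnson graph `J(3d-2, d)`. -/
noncomputable def kernelMatrix (d : ℕ) :
    Matrix {s : Finset (Fin (3 * d - 2)) // s.card = d}
      {s : Finset (Fin (3 * d - 2)) // s.card = d} ℝ :=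
  Matrix.of fun S T => kernelEntry d (S.1 ∩ T.1).card

theorem kernelMatrix_mem {d : ℕ} (hd : 2 ≤ d) :
    kernelMatrix d ∈ symmetricMatrices (johnsonGraph (3 * d - 2) d)ᶜ := by
  refine ⟨?_, fun S T hST => ?_⟩
  · ext S T
    simp [kernelMatrix, Finset.inter_comm]
  · simp [kernelMatrix, kernelEntry_eq_zero_iff hd, SimpleGraph.compl_adj, hST, johnsonGraph]

theorem exists_kernelMatrix_mul_self {d : ℕ} (hd : 2 ≤ d) :
    ∃ c : ℝ, kernelMatrix d * kernelMatrix d = c • kernelMatrix d := by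
  obtain ⟨c, hc⟩ := exists_eigenvalue_of_swapSum_eq_zero (α := Fin (3 * d - 2)) d (kernelEntry d)
  refine ⟨c, ?_⟩
  ext S T
  -- Column `T` of the matrix lies in ker `A`.
  have h := hc (fun U => kernelEntry d (U ∩ T.1).card) (fun U hU => by
    rw [swapSum_card_inter hU T.2, Fintype.card_fin]
    exact swapCoeff_kernelEntry hd
      ((Finset.card_le_card Finset.inter_subset_left).trans_eq hU)) S.1 S.2
  rw [Matrix.smul_apply, smul_eq_mul, Matrix.mul_apply]
  refine Eq.trans ?_ h
  exact (Finset.sum_subtype (Finset.univ.powersetCard d) (by simp)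
    fun U => kernelEntry d (S.1 ∩ U).card * kernelEntry d (U ∩ T.1).card).symm

theorem exists_compl_johnsonGraph_adj {d : ℕ} (hd : 2 ≤ d) :
    ∃ S T, (johnsonGraph (3 * d - 2) d)ᶜ.Adj S T := by
  obtain ⟨S, -, hS⟩ := Finset.exists_subset_card_eq
    (s := (Finset.univ : Finset (Fin (3 * d - 2)))) (n := d) (by simp; omega)
  -- A disjoint `d`-set fits because `2d - 2 ≥ d`; disjoint sets are not Johnson neighbours since `d
  -- ≠ 1`.
  obtain ⟨T, hTS, hT⟩ := Finset.exists_subset_card_eq (s := Sᶜ) (n := d) (by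
    rw [Finset.card_compl, hS, Fintype.card_fin]; omega)
  have hdisj : S ∩ T = ∅ :=
    Finset.disjoint_iff_inter_eq_empty.1 (Finset.subset_compl_iff_disjoint_left.1 hTS)
  refine ⟨⟨S, hS⟩, ⟨T, hT⟩, (SimpleGraph.compl_adj _ _ _).2 ⟨fun h => ?_, fun h => ?_⟩⟩
  · rw [Subtype.mk.injEq] at h
    rw [← h, Finset.inter_self] at hdisj
    rw [hdisj, Finset.card_empty] at hS
    omega
  · have h' : (S ∩ T).card + 1 = d := h
    rw [hdisj, Finset.card_empty] at h'
    omega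

theorem theorem5p4 (d : ℕ) (hd : 2 ≤ d) :
    minDistinctEigenvalues (johnsonGraph (3 * d - 2) d)ᶜ = 2 := by
  obtain ⟨S, T, hST⟩ := exists_compl_johnsonGraph_adj hd
  obtain ⟨c, hc⟩ := exists_kernelMatrix_mul_self hd
  refine le_antisymm ?_ (two_le_minDistinctEigenvalues hST ⟨_, kernelMatrix_mem hd⟩)
  exact (Nat.sInf_le (Set.mem_image_of_mem _ (kernelMatrix_mem hd))).trans
    (numDistinctEigenvalues_le_two hc)
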